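/- Let $M,N\ge 1$. Let $\mathcal S_{M,N}$ be the set of separable states on $\mathbf C^M\otimes\mathbf C^N$, i.e. operators $\sum_i p_i\,\rho^A_i\otimes\rho^B_i$ (finite sums, $p_i\ge 0$, $\sum_i p_i=1$) with density operators $\rho^A_i$ on $\mathbf C^M$ and $\rho^B_i$ on $\mathbf C^N$. Let $\mathcal H$ be the real affine space of Hermitian operators of trace $1$ on $\mathbf C^M\otimes\mathbf C^N$, with the trace distance $\operatorname{tr}|X-Y|$, where $|Z|=\sqrt{Z^\dagger Z}$. For $X\in\mathcal H$ and $\delta>0$ put $B(X,\delta)=\{Y\in\mathcal H:\operatorname{tr}|X-Y|\le\delta\}$, and for $K\subseteq\mathcal H$ put $S(K,\delta)=\bigcup_{X\in K}B(X,\delta)$ and $S(K,-\delta)=\{X\in\mathcal H: B(X,\delta)\subseteq K\}$. A test that on each input $p\in\mathcal H$ asserts either "$p\in S(K,\delta)$" or "$p\notin S(K,-\delta)$" solves the weak membership problem $\mathrm{WMEM}(K)$ (with respect to the trace distance) with accuracy $\delta$ if its assertion is true for every $p\in\mathcal H$. A Bose-symmetric extension of $\rho$ to $k\ge 1$ copies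 of subsystem $A$ is a density operator $\rho'$ on $(\mathbf C^M)^{\otimes k}\otimes\mathbf C^N$ such that tracing out any $k-1$ of the copies of $\mathbf C^M$ gives $\rho$, and $(P\otimes I)\rho'=\rho'$ for all $k!$ permutation operators $P$ of the $k$ copies (hence $\rho'$ is also unchanged under conjugation by swaps of any two copies). **Corollary.** Let $\delta>0$ and $\bar k=\lceil 4M/\delta\rceil$. To solve $\mathrm{WMEM}(\mathcal S_{M,N})$ with respect to the trace distance with accuracy $\delta$, it suffices to look for Bose-symmetric extensions to $\bar k$ copies of subsystem $A$: the test that asserts $p\in S(\mathcal S_{M,N},\delta)$ if $p$ has a Bose-symmetric extension to $\bar k$ copies of subsystem $A$, and asserts $p\notin S(\mathcal S_{M,N},-\delta)$ otherwise, solves $\mathrm{WMEM}(\mathcal S_{M,N})$ with accuracy $\delta$. -/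

import Mathlib

open scoped Kronecker MatrixOrder ComplexOrder

namespace QuantumSep

/-- Operators on `ℂ^M ⊗ ℂ^N`, written as matrices in the standard product basis. -/
abbrev BipOp (M N : ℕ) : Type := Matrix (Fin M × Fin N) (Fin M × Fin N) ℂ

/-- Operators on `(ℂ^M)^{⊗ k} ⊗ ℂ^N`; a function `Fin k → Fin M` indexes the standard basis
of `(ℂ^M)^{⊗ k}`. -/
abbrev ExtOp (M N k : ℕ) : Type :=
  Matrix ((Fin k → Fin M) × Fin N) ((Fin k → Fin M) × Fin N) ℂ

/-- Density operators: positive semidefinite (in particular Hermitian) of unit trace. -/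
def IsDensity {ι : Type*} [Fintype ι] (X : Matrix ι ι ℂ) : Prop :=
  X.PosSemidef ∧ X.trace = 1

/-- The set `S_{M,N}` of separable states: finite convex combinations of products of density
operators. -/
def separableStates (M N : ℕ) : Set (BipOp M N) :=
  {ρ | ∃ (n : ℕ) (p : Fin n → ℝ) (α : Fin n → Matrix (Fin M) (Fin M) ℂ)
      (β : Fin n → Matrix (Fin N) (Fin N) ℂ),
      (∀ i, 0 ≤ p i) ∧ ∑ i, p i = 1 ∧ (∀ i, IsDensity (α i)) ∧ (∀ i, IsDensity (β i)) ∧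
      ρ = ∑ i, (p i : ℂ) • (α i ⊗ₖ β i)}

/-- The operator `P` on `(ℂ^M)^{⊗ k}` that permutes the tensor factors by `π`: it sends the
basis vector `e_t` to `e_{t ∘ π⁻¹}`. -/
def permOp (M : ℕ) {k : ℕ} (π : Equiv.Perm (Fin k)) :
    Matrix (Fin k → Fin M) (Fin k → Fin M) ℂ :=
  Matrix.of fun s t => if t = s ∘ π then 1 else 0

/-- The same permutation operator on `(ℂ^M)^{⊗ k} ⊗ ℂ^N`, acting as the identity on `ℂ^N`. -/
def copyPerm (M N : ℕ) {k : ℕ} (π : Equiv.Perm (Fin k)) : ExtOp M N k :=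
  permOp M π ⊗ₖ (1 : Matrix (Fin N) (Fin N) ℂ)

/-- Partial trace over all copies of the first subsystem except copy `j`. The sum runs over the
row multi-indices `s` with `s j = a`; the column multi-index agrees with `s` off `j`. -/
def traceOutExcept {M N k : ℕ} (j : Fin k) (X : ExtOp M N k) : BipOp M N :=
  Matrix.of fun x y =>
    ∑ s : Fin k → Fin M,
      if s j = x.1 then X (s, x.2) (Function.update s j y.1, y.2) else 0

/-- `ρ'` is a symmetric extension of `ρ` to `k` copies of the first subsystem: a density operator
that is unchanged by swapping any two copies and gives back `ρ` when any `k - 1` of the copies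
are traced out. -/
structure IsSymmetricExtension {M N k : ℕ} (ρ : BipOp M N) (ρ' : ExtOp M N k) : Prop where
  density : IsDensity ρ'
  swap_invariant : ∀ i j : Fin k,
    copyPerm M N (Equiv.swap i j) * ρ' * (copyPerm M N (Equiv.swap i j)).conjTranspose = ρ'
  extends_state : ∀ j : Fin k, traceOutExcept j ρ' = ρ

/-- Bose-symmetric extension: moreover `P ρ' = ρ'` for all `k!` permutations `P` of the copies. -/
structure IsBoseSymmetricExtension {M N k : ℕ} (ρ : BipOp M N) (ρ' : ExtOp M N k) : Prop
    extends IsSymmetricExtension ρ ρ' where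
  bose : ∀ π : Equiv.Perm (Fin k), copyPerm M N π * ρ' = ρ'

/-- The search for a Bose-symmetric extension to `k` copies of the first subsystem succeeds. -/
def HasBoseSymmetricExtension {M N : ℕ} (k : ℕ) (ρ : BipOp M N) : Prop :=
  ∃ ρ' : ExtOp M N k, IsBoseSymmetricExtension ρ ρ'

/-- Trace distance `tr |X - Y|` (without a factor `1/2`), where `|Z| = √(Z† Z)`. -/
noncomputable def traceDist {M N : ℕ} (X Y : BipOp M N) : ℝ :=
  (CFC.abs (X - Y)).trace.re

/-- The Hermitian operators of unit trace: the real affine space of dimension `M² N² - 1` in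
which the separable states form a full-dimensional convex set. Weak membership is posed in it. -/
def stateSpace (M N : ℕ) : Set (BipOp M N) :=
  {X | X.IsHermitian ∧ X.trace = 1}

/-- The closed ball `B(X, δ)` for the trace distance, in `stateSpace M N`. -/
def traceBall {M N : ℕ} (X : BipOp M N) (δ : ℝ) : Set (BipOp M N) :=
  {Y | Y ∈ stateSpace M N ∧ traceDist X Y ≤ δ}

/-- `S(K, δ)`: the union of the balls `B(X, δ)` with `X ∈ K`. -/
def outerSet {M N : ℕ} (K : Set (BipOp M N)) (δ : ℝ) : Set (BipOp M N) :=
  ⋃ X ∈ K, traceBall X δ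

/-- `S(K, -δ)`: the points `X` with `B(X, δ) ⊆ K`. -/
def innerSet {M N : ℕ} (K : Set (BipOp M N)) (δ : ℝ) : Set (BipOp M N) :=
  {X | X ∈ stateSpace M N ∧ traceBall X δ ⊆ K}

/-- The test that asserts `p ∈ S(K, δ)` when `accept p` holds, and asserts `p ∉ S(K, -δ)`
otherwise, solves the weak membership problem for `K` with accuracy `δ` (with respect to the trace
distance): on every input `p` its assertion is correct. -/
def SolvesWMEM {M N : ℕ} (K : Set (BipOp M N)) (δ : ℝ) (accept : BipOp M N → Prop) : Prop :=
  ∀ p ∈ stateSpace M N,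
    (accept p → p ∈ outerSet K δ) ∧ (¬ accept p → p ∉ innerSet K δ)

end QuantumSep

namespace QuantumSep

open scoped Nat

/-! The two assertions amount to a finite de Finetti estimate and its easy converse. Let X be a
Bose-symmetric extension of ρ to k copies, with marginal X_B on the second subsystem. Contract the k
copies with a vector v and prepare v: the standard complex Gaussian average of v vᴴ ⊗
⟨v^{⊗k}|X|v^{⊗k}⟩ is a positive mixture of product operators. Wick's formula turns it into a sum
over permutations of k + 1 slots; Bose symmetry absorbs the permutations of k slots and leaves k! (1
⊗ X_B + k ρ) (`sum_vecMulVec_kronecker_contractCopies`). Division by k! (k + M) gives a separable σ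
with σ - ρ = (1 ⊗ X_B - M ρ) / (k + M), of trace norm at most 2M / (k + M)
(`exists_separable_traceDist_le`). For k ≥ 4M/δ this is at most δ/2.

Conversely, a separable state is a mixture of operators u uᴴ ⊗ β, each extended by (u uᴴ)^{⊗k} ⊗ β
(`hasBoseSymmetricExtension_of_separable`).

Separable states are finite mixtures, and only moments of degree at most k + 1 in v and in its
conjugate enter, so a finite quadrature replaces the Gaussian measure
(`exists_gaussian_quadrature`). -/

/-! ### Finite quadratures for the exponential and Gaussian laws -/

theorem sum_eq_sum_of_embedding {ι κ F : Type*} [Fintype ι] [Fintype κ] [AddCommMonoid F]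
    (e : ι ↪ κ) {g : ι → F} {h : κ → F} (h1 : ∀ i, h (e i) = g i)
    (h2 : ∀ j, j ∉ Set.range e → h j = 0) : ∑ j, h j = ∑ i, g i := by
  rw [← Finset.sum_congr rfl fun i _ => h1 i, ← Finset.sum_map Finset.univ e h]
  symm
  apply Finset.sum_subset (Finset.subset_univ _)
  intro j _ hj
  exact h2 j fun ⟨i, hi⟩ => hj (by simp [← hi])

/-- In finite dimension the convex hull of a compact set is compact. -/
theorem isCompact_convexHull_of_finiteDimensional {E : Type*} [NormedAddCommGroup E]
    [NormedSpace ℝ E] [FiniteDimensional ℝ E] {s : Set E} (hs : IsCompact s) :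
    IsCompact (convexHull ℝ s) := by
  classical
  rcases s.eq_empty_or_nonempty with rfl | ⟨x₀, hx₀⟩
  · simp
  set n := Module.finrank ℝ E + 1
  -- Carathéodory: n = dim + 1 points suffice, so the hull is a continuous image of a compact set.
  have key : convexHull ℝ s = (fun q : (Fin n → ℝ) × (Fin n → E) => ∑ i, q.1 i • q.2 i) ''
      (stdSimplex ℝ (Fin n) ×ˢ Set.univ.pi fun _ => s) := by
    apply Set.Subset.antisymm
    · intro x hx
      obtain ⟨ι, _, z, w, hz, hind, hw, hw1, rfl⟩ := eq_pos_convex_span_of_mem_convexHull hx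
      have hcard : Fintype.card ι ≤ Fintype.card (Fin n) := by
        simpa [n] using (AffineIndependent.card_le_finrank_succ hind).trans
          (Nat.add_le_add_right (Submodule.finrank_le _) 1)
      obtain ⟨e⟩ := Function.Embedding.nonempty_of_card_le hcard
      have hw' : ∀ i, Function.extend e w 0 (e i) = w i := fun i => e.injective.extend_apply _ _ _
      have hw0 : ∀ j, j ∉ Set.range e → Function.extend e w 0 j = 0 := fun j hj => by
        rw [Function.extend_apply' _ _ _ hj]; rfl
      -- Shorter combinations are padded with weight 0 at the point x₀.
      refine ⟨(Function.extend e w 0, Function.extend e z fun _ => x₀),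
        ⟨⟨fun j => ?_, ?_⟩, fun j _ => ?_⟩, ?_⟩
      · by_cases hj : j ∈ Set.range e
        · obtain ⟨i, rfl⟩ := hj
          simpa [hw'] using (hw i).le
        · simp [hw0 j hj]
      · rw [← hw1]
        exact sum_eq_sum_of_embedding e hw' hw0
      · by_cases hj : j ∈ Set.range e
        · obtain ⟨i, rfl⟩ := hj
          simpa [e.injective.extend_apply] using hz ⟨i, rfl⟩
        · simpa [Function.extend_apply' _ _ _ hj] using hx₀
      · refine sum_eq_sum_of_embedding e (fun i => ?_) fun j hj => ?_
        · simp [e.injective.extend_apply]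
        · simp [hw0 j hj]
    · rintro _ ⟨q, ⟨⟨h0, h1⟩, hq⟩, rfl⟩
      exact (convex_convexHull ℝ s).sum_mem (fun i _ => h0 i) h1
        fun i _ => subset_convexHull ℝ s (hq i trivial)
  rw [key]
  refine ((isCompact_stdSimplex ℝ _).prod (isCompact_univ_pi fun _ => hs)).image ?_
  fun_prop

/-- Each logarithm is paired with a factor u, because u log u is continuous at 0. -/
theorem pow_mul_log_pow_eq {K m : ℕ} (hm : m ≤ K) (u : ℝ) :
    u ^ K * Real.log u ^ m = u ^ (K - m) * (u * Real.log u) ^ m := by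
  rw [mul_pow, ← mul_assoc, ← pow_add, Nat.sub_add_cancel hm]

theorem continuous_pow_mul_log_pow {K m : ℕ} (hm : m ≤ K) :
    Continuous fun u : ℝ => u ^ K * Real.log u ^ m := by
  simp_rw [pow_mul_log_pow_eq hm]
  exact (continuous_id.pow _).mul (Real.continuous_mul_log.pow _)

/-- Integration by parts: u^(K+1) log^(m+1) u vanishes at both ends, which gives a recursion in m.
-/
theorem integral_pow_mul_log_pow {K m : ℕ} (hm : m ≤ K) :
    ∫ u in (0 : ℝ)..1, u ^ K * Real.log u ^ m = (-1) ^ m * m ! / (K + 1) ^ (m + 1) := by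
  induction m with
  | zero => simp
  | succ m ih =>
    have hK : (K : ℝ) + 1 ≠ 0 := by positivity
    have h := intervalIntegral.integral_eq_sub_of_hasDerivAt_of_le (zero_le_one' ℝ)
      (f := fun u : ℝ => u ^ (K + 1) * Real.log u ^ (m + 1))
      (f' := fun u => (K + 1) * (u ^ K * Real.log u ^ (m + 1)) +
        (m + 1) * (u ^ K * Real.log u ^ m))
      (continuous_pow_mul_log_pow (by omega)).continuousOn
      (fun u hu => by
        have hu0 : u ≠ 0 := hu.1.ne'
        refine ((hasDerivAt_pow (K + 1) u).mul
          ((Real.hasDerivAt_log hu0).pow (m + 1))).congr_deriv ?_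
        push_cast
        simp only [Pi.pow_apply, pow_succ u K]
        field_simp)
      (Continuous.intervalIntegrable
        (((continuous_pow_mul_log_pow hm).const_mul _).add
          ((continuous_pow_mul_log_pow (by omega)).const_mul _)) _ _)
    rw [intervalIntegral.integral_add
        (((continuous_pow_mul_log_pow hm).const_mul _).intervalIntegrable _ _)
        (((continuous_pow_mul_log_pow (by omega)).const_mul _).intervalIntegrable _ _),
      intervalIntegral.integral_const_mul, intervalIntegral.integral_const_mul,
      ih (by omega)] at h
    simp only [Real.log_one, one_pow, ne_eq, Nat.add_eq_zero_iff, one_ne_zero, and_false,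
      not_false_eq_true, zero_pow, mul_zero, zero_mul, sub_zero] at h
    have h' := eq_neg_of_add_eq_zero_left h
    rw [mul_comm, ← eq_div_iff hK] at h'
    rw [h', Nat.factorial_succ]
    push_cast
    field_simp
    ring

/-- A finite quadrature with nonnegative nodes and weights for the exponential distribution,
exact in degree at most `K`. -/
theorem exists_exponential_quadrature (K : ℕ) :
    ∃ (J : Type) (_ : Fintype J) (w x : J → ℝ), (∀ j, 0 ≤ w j) ∧ (∀ j, 0 ≤ x j) ∧
      ∀ m ≤ K, ∑ j, w j * x j ^ m = m ! := by
  -- The substitution x = -(K+1) log u turns e^(-x) dx into (K+1) u^K du on (0, 1], so the moments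
  -- become the mean of a continuous curve on a compact interval.
  set c : ℝ → Fin (K + 1) → ℝ := fun u m => u ^ K * Real.log u ^ (m : ℕ)
  have hc : Continuous c := continuous_pi fun m =>
    continuous_pow_mul_log_pow (Nat.le_of_lt_succ m.2)
  have hC : IsCompact (convexHull ℝ (c '' Set.Icc 0 1)) :=
    isCompact_convexHull_of_finiteDimensional (isCompact_Icc.image hc)
  have hprob : MeasureTheory.IsProbabilityMeasure
      (MeasureTheory.volume.restrict (Set.Ioc (0 : ℝ) 1)) := ⟨by simp⟩
  have hint : MeasureTheory.Integrable c (MeasureTheory.volume.restrict (Set.Ioc (0 : ℝ) 1)) :=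
    (hc.integrableOn_Icc (a := 0) (b := 1)).mono_set Set.Ioc_subset_Icc_self
  -- The mean lies in the closed convex hull, hence is a finite convex combination of points of the
  -- curve.
  have hmem := (convex_convexHull ℝ (c '' Set.Icc 0 1)).integral_mem hC.isClosed
    (MeasureTheory.ae_restrict_of_forall_mem measurableSet_Ioc fun u hu =>
      subset_convexHull ℝ _ (Set.mem_image_of_mem c (Set.Ioc_subset_Icc_self hu))) hint
  obtain ⟨J, _, z, p, hz, -, hp, -, hpz⟩ := eq_pos_convex_span_of_mem_convexHull hmem
  choose u hu huz using fun j => hz ⟨j, rfl⟩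
  have hK : (0 : ℝ) < K + 1 := by positivity
  refine ⟨J, inferInstance, fun j => (K + 1) * p j * u j ^ K,
    fun j => -((K + 1) * Real.log (u j)), fun j => ?_, fun j => ?_, fun m hm => ?_⟩
  · have := (hp j).le
    have := (hu j).1
    positivity
  · exact neg_nonneg.2 (mul_nonpos_of_nonneg_of_nonpos hK.le
      (Real.log_nonpos (hu j).1 (hu j).2))
  · have h := congrFun hpz ⟨m, Nat.lt_succ_of_le hm⟩
    rw [MeasureTheory.eval_integral fun i => hint.eval i,
      ← intervalIntegral.integral_of_le zero_le_one, integral_pow_mul_log_pow hm] at h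
    simp only [← huz, Finset.sum_apply, Pi.smul_apply, smul_eq_mul, c] at h
    have h2 : ∀ j, (K + 1) * p j * u j ^ K * (-((K + 1) * Real.log (u j))) ^ m =
        (-1) ^ m * (K + 1) ^ (m + 1) * (p j * (u j ^ K * Real.log (u j) ^ m)) := fun j => by
      rw [neg_pow, mul_pow]; ring
    rw [Finset.sum_congr rfl fun j _ => h2 j, ← Finset.mul_sum, h]
    have h3 : ((-1 : ℝ) ^ m) * (-1) ^ m = 1 := by rw [← mul_pow]; simp
    field_simp
    linear_combination h3

/-- A finite quadrature for the standard complex Gaussian, exact for `z ^ m * conj z ^ n` with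
`m, n ≤ K`. -/
theorem exists_gaussian_quadrature (K : ℕ) :
    ∃ (J : Type) (_ : Fintype J) (w : J → ℝ) (z : J → ℂ), (∀ j, 0 ≤ w j) ∧
      ∀ m ≤ K, ∀ n ≤ K,
        ∑ j, (w j : ℂ) * (z j ^ m * star (z j) ^ n) = if m = n then (m ! : ℂ) else 0 := by
  obtain ⟨J, _, w, x, hw, hx, h⟩ := exists_exponential_quadrature K
  set L := K + 1
  obtain ⟨ζ, hζ⟩ : ∃ ζ : ℂ, IsPrimitiveRoot ζ L :=
    ⟨_, Complex.isPrimitiveRoot_exp L (Nat.succ_ne_zero K)⟩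
  have hζ0 : ζ ≠ 0 := hζ.ne_zero (Nat.succ_ne_zero K)
  have hζs : star ζ = ζ⁻¹ :=
    (Complex.inv_eq_conj (hζ.norm'_eq_one (Nat.succ_ne_zero K))).symm
  -- The squared modulus is exponentially distributed and the phase uniform on the L-th roots of
  -- unity. Since |m - n| ≤ K < L, the phase average vanishes for m ≠ n.
  refine ⟨J × Fin L, inferInstance, fun q => w q.1 / L,
    fun q => (Real.sqrt (x q.1) : ℂ) * ζ ^ (q.2 : ℕ), fun q => div_nonneg (hw _) (by positivity),
    fun m hm n hn => ?_⟩
  have hterm : ∀ q : J × Fin L, ((w q.1 / L : ℝ) : ℂ) *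
      (((Real.sqrt (x q.1) : ℂ) * ζ ^ (q.2 : ℕ)) ^ m *
        star ((Real.sqrt (x q.1) : ℂ) * ζ ^ (q.2 : ℕ)) ^ n) =
      ((w q.1 : ℂ) * (Real.sqrt (x q.1) : ℂ) ^ (m + n)) * ((ζ ^ m * ζ⁻¹ ^ n) ^ (q.2 : ℕ) / L) := by
    intro q
    have : star (Real.sqrt (x q.1) : ℂ) = Real.sqrt (x q.1) := Complex.conj_ofReal _
    simp only [star_mul', star_pow, hζs, this]
    push_cast
    ring
  have hL0 : (L : ℂ) ≠ 0 := by exact_mod_cast Nat.succ_ne_zero K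
  rw [Finset.sum_congr rfl fun q _ => hterm q, Fintype.sum_prod_type]
  simp only [← Finset.mul_sum]
  rw [← Finset.sum_mul, ← Finset.sum_div, Fin.sum_univ_eq_sum_range (fun i => (ζ ^ m * ζ⁻¹ ^ n) ^ i)]
  split_ifs with hmn
  · subst hmn
    have h1 : ζ ^ m * ζ⁻¹ ^ m = 1 := by rw [← mul_pow, mul_inv_cancel₀ hζ0, one_pow]
    simp only [h1, one_pow, Finset.sum_const, Finset.card_range, nsmul_eq_mul, mul_one,
      div_self hL0]
    have h2 := congrArg (fun r : ℝ => (r : ℂ)) (h m hm)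
    push_cast at h2
    rw [← h2]
    refine Finset.sum_congr rfl fun j _ => ?_
    rw [← two_mul, pow_mul, ← Complex.ofReal_pow, Real.sq_sqrt (hx j)]
  · have h1 : ζ ^ m * ζ⁻¹ ^ n ≠ 1 := by
      intro h1
      rw [inv_pow, mul_inv_eq_one₀ (pow_ne_zero _ hζ0)] at h1
      exact hmn (hζ.pow_inj (by omega) (by omega) h1)
    rw [geom_sum_eq h1, mul_pow, ← pow_mul, ← pow_mul, mul_comm m, mul_comm n, pow_mul, pow_mul,
      inv_pow, hζ.pow_eq_one]
    simp

/-! ### Wick's formula -/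

theorem prod_comp_eq_prod_pow_card {ι κ R : Type*} [Fintype ι] [Fintype κ] [DecidableEq κ]
    [CommMonoid R] (g : κ → R) (s : ι → κ) :
    ∏ i, g (s i) = ∏ a, g a ^ Fintype.card {i // s i = a} := by
  rw [← Finset.prod_fiberwise Finset.univ s]
  refine Finset.prod_congr rfl fun a _ => ?_
  rw [Finset.prod_congr rfl fun i hi => by rw [(Finset.mem_filter.1 hi).2], Finset.prod_const,
    Fintype.card_subtype]

/-- If the fibres of s and t have equal sizes, the permutations counted form a coset of the
stabilizer of s, whose order is the product of the factorials; otherwise there are none. -/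
theorem sum_perm_eq_comp {ι κ R : Type*} [Fintype ι] [DecidableEq ι] [Fintype κ] [DecidableEq κ]
    [CommSemiring R] (s t : ι → κ) :
    (∑ π : Equiv.Perm ι, if t = s ∘ π then (1 : R) else 0) =
      ∏ a, if Fintype.card {i // s i = a} = Fintype.card {i // t i = a}
        then ((Fintype.card {i // s i = a})! : R) else 0 := by
  by_cases h : ∀ a, Fintype.card {i // s i = a} = Fintype.card {i // t i = a}
  · obtain ⟨σ, hσ⟩ : ∃ σ : Equiv.Perm ι, t = s ∘ σ :=
      ⟨Equiv.ofFiberEquiv fun a => (Fintype.equivOfCardEq (h a)).symm,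
        funext fun i => (Equiv.ofFiberEquiv_map _ i).symm⟩
    rw [Finset.prod_congr rfl fun a _ => if_pos (h a), ← Nat.cast_prod, ← DomMulAct.stabilizer_card,
      ← Equiv.sum_comp (Equiv.mulRight σ), Finset.sum_boole, Fintype.card_subtype]
    congr 2
    ext π
    simp only [Finset.mem_filter, Finset.mem_univ, true_and, Equiv.coe_mulRight, hσ,
      Equiv.Perm.coe_mul, ← Function.comp_assoc]
    rw [σ.surjective.injective_comp_right.eq_iff, eq_comm]
  · obtain ⟨a, ha⟩ := not_forall.1 h
    rw [Finset.prod_eq_zero (Finset.mem_univ a) (if_neg ha)]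
    refine Finset.sum_eq_zero fun π _ => if_neg ?_
    rintro rfl
    exact ha (Fintype.card_congr (π.subtypeEquiv fun i => Iff.rfl)).symm

/-- Wick's formula for a quadrature of independent standard complex Gaussians. -/
theorem sum_prod_mul_star_prod {J ι κ : Type*} [Fintype J] [Fintype ι] [DecidableEq ι]
    [Fintype κ] [DecidableEq κ] {w : J → ℝ} {z : J → ℂ}
    (h : ∀ m ≤ Fintype.card ι, ∀ n ≤ Fintype.card ι,
      ∑ j, (w j : ℂ) * (z j ^ m * star (z j) ^ n) = if m = n then (m ! : ℂ) else 0)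
    (s t : ι → κ) :
    ∑ f : κ → J, (∏ a, (w (f a) : ℂ)) * ((∏ i, z (f (s i))) * star (∏ i, z (f (t i)))) =
      ∑ π : Equiv.Perm ι, if t = s ∘ π then 1 else 0 := by
  rw [sum_perm_eq_comp, Finset.prod_congr rfl fun a _ => (h _ (Fintype.card_subtype_le _) _
    (Fintype.card_subtype_le _)).symm, Finset.prod_univ_sum, Fintype.piFinset_univ]
  refine Finset.sum_congr rfl fun f _ => ?_
  rw [prod_comp_eq_prod_pow_card (fun a => z (f a)) s,
    prod_comp_eq_prod_pow_card (fun a => z (f a)) t, star_prod, ← Finset.prod_mul_distrib,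
    ← Finset.prod_mul_distrib]
  simp only [star_pow]

section

variable {M N k : ℕ}

/-! ### Separable operators, partial traces, measure-and-prepare -/

theorem mem_separableStates_of_fintype {J : Type*} [Fintype J] {p : J → ℝ}
    {α : J → Matrix (Fin M) (Fin M) ℂ} {β : J → Matrix (Fin N) (Fin N) ℂ}
    (hp : ∀ j, 0 ≤ p j) (hp1 : ∑ j, p j = 1) (hα : ∀ j, IsDensity (α j))
    (hβ : ∀ j, IsDensity (β j)) :
    ∑ j, (p j : ℂ) • (α j ⊗ₖ β j) ∈ separableStates M N := by
  let e := (Fintype.equivFin J).symm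
  exact ⟨Fintype.card J, p ∘ e, α ∘ e, β ∘ e, fun i => hp _, by rw [← hp1, ← e.sum_comp]; rfl,
    fun i => hα _, fun i => hβ _, by rw [← e.sum_comp]; rfl⟩

theorem _root_.Matrix.PosSemidef.trace_eq_re {ι : Type*} [Fintype ι] {A : Matrix ι ι ℂ}
    (hA : A.PosSemidef) : A.trace = (A.trace.re : ℂ) :=
  (Complex.eq_re_of_ofReal_le (r := 0) (by simpa using hA.trace_nonneg))

theorem isDensity_normalize {ι : Type*} [Fintype ι] {A : Matrix ι ι ℂ}
    (hA : A.PosSemidef) (h : A.trace ≠ 0) : IsDensity (((A.trace.re)⁻¹ : ℝ) • A : Matrix ι ι ℂ) := by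
  refine ⟨hA.smul (inv_nonneg.2 (Complex.nonneg_iff.1 hA.trace_nonneg).1), ?_⟩
  rw [Matrix.trace_smul, Complex.real_smul, Complex.ofReal_inv, ← hA.trace_eq_re, inv_mul_cancel₀ h]

/-- A sum of products of positive semidefinite operators is separable once it has unit trace. -/
theorem sum_kronecker_mem_separableStates {J : Type*} [Fintype J]
    {A : J → Matrix (Fin M) (Fin M) ℂ} {B : J → Matrix (Fin N) (Fin N) ℂ}
    (hA : ∀ j, (A j).PosSemidef) (hB : ∀ j, (B j).PosSemidef)
    (h1 : (∑ j, A j ⊗ₖ B j).trace = 1) :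
    ∑ j, A j ⊗ₖ B j ∈ separableStates M N := by
  classical
  -- Factors of trace 0 cannot be normalized, but being positive they vanish.
  let S := {j // (A j).trace ≠ 0 ∧ (B j).trace ≠ 0}
  have hsum : ∑ j, A j ⊗ₖ B j = ∑ j : S, A j ⊗ₖ B j := by
    refine sum_eq_sum_of_embedding (Function.Embedding.subtype _) (fun _ => rfl) fun j hj => ?_
    replace hj := fun h => hj ⟨⟨j, h⟩, rfl⟩
    rcases not_and_or.1 hj with h | h
    · rw [(hA j).trace_eq_zero_iff.1 (not_not.1 h), Matrix.zero_kronecker]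
    · rw [(hB j).trace_eq_zero_iff.1 (not_not.1 h), Matrix.kronecker_zero]
  have hre : ∀ {n : ℕ} {C : Matrix (Fin n) (Fin n) ℂ}, C.PosSemidef → 0 ≤ C.trace.re :=
    fun h => (Complex.nonneg_iff.1 h.trace_nonneg).1
  have hne : ∀ {n : ℕ} {C : Matrix (Fin n) (Fin n) ℂ}, C.PosSemidef → C.trace ≠ 0 →
      C.trace.re ≠ 0 := fun h h0 h' => h0 (by rw [h.trace_eq_re, h', Complex.ofReal_zero])
  have := mem_separableStates_of_fintype (J := S)
    (p := fun j => (A j).trace.re * (B j).trace.re)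
    (fun j => mul_nonneg (hre (hA j)) (hre (hB j))) ?_
    (fun j => isDensity_normalize (hA j) j.2.1) (fun j => isDensity_normalize (hB j) j.2.2)
  · rw [hsum]
    convert this using 2 with j
    have h1 := hne (hA j) j.2.1
    have h2 := hne (hB j) j.2.2
    ext x y
    simp only [Matrix.smul_apply, Matrix.kroneckerMap_apply, Complex.real_smul, smul_eq_mul]
    push_cast
    have h1' : ((A j).trace.re : ℂ) ≠ 0 := by exact_mod_cast h1
    have h2' : ((B j).trace.re : ℂ) ≠ 0 := by exact_mod_cast h2
    field_simp
  · rw [hsum, Matrix.trace_sum] at h1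
    have h2 := congrArg Complex.re h1
    rw [Complex.re_sum, Complex.one_re] at h2
    rw [← h2]
    refine Finset.sum_congr rfl fun j _ => ?_
    rw [Matrix.trace_kronecker, (hA j).trace_eq_re, (hB j).trace_eq_re]
    simp

theorem sum_ite_apply_eq {ι κ F : Type*} [Fintype ι] [DecidableEq ι] [Fintype κ] [DecidableEq κ]
    [AddCommMonoid F] (i : ι) (a c : κ) (G : (ι → κ) → F) :
    (∑ s, if s i = a then G s else 0) =
      ∑ t, if t i = c then G (Function.update t i a) else 0 := by
  rw [← Finset.sum_filter, ← Finset.sum_filter]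
  refine Finset.sum_nbij' (fun s => Function.update s i c) (fun t => Function.update t i a) ?_ ?_
    ?_ ?_ ?_ <;> simp +contextual [Function.update_eq_self_iff]
  rintro s rfl
  rw [Function.update_eq_self]

theorem traceOutExcept_apply (j : Fin k) (X : ExtOp M N k) (a b : Fin M) (x y : Fin N) :
    traceOutExcept j X (a, x) (b, y) =
      ∑ t : Fin k → Fin M, if b = t j then X (Function.update t j a, x) (t, y) else 0 := by
  simp only [traceOutExcept, Matrix.of_apply]
  rw [sum_ite_apply_eq j a b]
  refine Finset.sum_congr rfl fun t _ => ?_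
  by_cases h : b = t j
  · subst h; simp
  · simp [h, Ne.symm h]

/-- The partial trace is a sum of submatrices of X, one for each configuration r of the other
copies; c only fixes a representative in slot j. -/
theorem traceOutExcept_posSemidef {X : ExtOp M N k} (hX : X.PosSemidef) (j : Fin k) :
    (traceOutExcept j X).PosSemidef := by
  rcases isEmpty_or_nonempty (Fin M) with hM | ⟨⟨c⟩⟩
  · rw [Subsingleton.elim (traceOutExcept j X) 0]
    exact Matrix.PosSemidef.zero
  · have : traceOutExcept j X = ∑ r ∈ Finset.univ.filter fun r : Fin k → Fin M => r j = c,
        X.submatrix (fun q => (Function.update r j q.1, q.2))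
          (fun q => (Function.update r j q.1, q.2)) := by
      ext x y
      rw [Matrix.sum_apply]
      simp only [traceOutExcept, Matrix.of_apply, Matrix.submatrix_apply]
      rw [sum_ite_apply_eq j x.1 c, Finset.sum_filter]
      simp
    rw [this]
    exact Matrix.posSemidef_sum _ fun r _ => hX.submatrix _

/-- Partial trace over all the copies of the first subsystem. -/
def traceOutCopies (X : ExtOp M N k) : Matrix (Fin N) (Fin N) ℂ :=
  ∑ t : Fin k → Fin M, X.submatrix (fun x => (t, x)) (fun x => (t, x))

theorem traceOutCopies_posSemidef {X : ExtOp M N k} (hX : X.PosSemidef) :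
    (traceOutCopies X).PosSemidef :=
  Matrix.posSemidef_sum _ fun _ _ => hX.submatrix _

theorem trace_traceOutCopies (X : ExtOp M N k) : (traceOutCopies X).trace = X.trace := by
  simp [traceOutCopies, Matrix.trace, Fintype.sum_prod_type, Matrix.sum_apply]
  rw [Finset.sum_comm]

theorem copyPerm_mul_apply (π : Equiv.Perm (Fin k)) (X : ExtOp M N k) (s : Fin k → Fin M)
    (x : Fin N) (q : (Fin k → Fin M) × Fin N) :
    (copyPerm M N π * X) (s, x) q = X (s ∘ π, x) q := by
  simp [copyPerm, permOp, Matrix.mul_apply, Fintype.sum_prod_type, Matrix.one_apply]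

/-- The operator on the second subsystem obtained by contracting every copy of the first subsystem
with `v`. -/
def contractCopies (v : Fin M → ℂ) (X : ExtOp M N k) : Matrix (Fin N) (Fin N) ℂ :=
  Matrix.of fun x y => ∑ s : Fin k → Fin M, ∑ t : Fin k → Fin M,
    star (∏ i, v (s i)) * X (s, x) (t, y) * ∏ i, v (t i)

/-- The contraction is Vᴴ X V with V = v^{⊗k} ⊗ 1. -/
theorem contractCopies_posSemidef (v : Fin M → ℂ) {X : ExtOp M N k} (hX : X.PosSemidef) :
    (contractCopies v X).PosSemidef := by
  convert hX.conjTranspose_mul_mul_same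
    (Matrix.of fun (q : (Fin k → Fin M) × Fin N) (y : Fin N) =>
      if q.2 = y then ∏ i, v (q.1 i) else 0) using 1
  ext x y
  simp only [contractCopies, Matrix.of_apply, Matrix.mul_apply, Fintype.sum_prod_type,
    Matrix.conjTranspose_apply, apply_ite star, star_zero, ite_mul, zero_mul, mul_ite, mul_zero,
    Finset.sum_ite_eq', Finset.mem_univ, if_true, Finset.sum_mul]
  rw [Finset.sum_comm]

/-- Integrating the measure-and-prepare map over Gaussian vectors, for Bose-symmetric operators. -/
theorem sum_vecMulVec_kronecker_contractCopies {J : Type*} [Fintype J] {w : J → ℝ} {z : J → ℂ}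
    (h : ∀ m ≤ k + 1, ∀ n ≤ k + 1,
      ∑ j, (w j : ℂ) * (z j ^ m * star (z j) ^ n) = if m = n then (m ! : ℂ) else 0)
    {X : ExtOp M N k} {ρ : BipOp M N} (hX : ∀ π : Equiv.Perm (Fin k), copyPerm M N π * X = X)
    (hρ : ∀ j, traceOutExcept j X = ρ) :
    ∑ f : Fin M → J, ((∏ a, (w (f a) : ℂ)) • Matrix.vecMulVec (z ∘ f) (star (z ∘ f))) ⊗ₖ
        contractCopies (z ∘ f) X =
      (k ! : ℂ) • ((1 : Matrix (Fin M) (Fin M) ℂ) ⊗ₖ traceOutCopies X + (k : ℂ) • ρ) := by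
  have hX' : ∀ (π : Equiv.Perm (Fin k)) s x q, X (s ∘ π, x) q = X (s, x) q := fun π s x q => by
    rw [← copyPerm_mul_apply (X := X), hX]
  ext ⟨a, x⟩ ⟨b, y⟩
  have hperm : ∀ (s t : Fin k → Fin M),
      (∑ π : Equiv.Perm (Fin (k + 1)), if (Fin.cons b s : Fin (k + 1) → Fin M) =
        (Fin.cons a t : Fin (k + 1) → Fin M) ∘ π then (1 : ℂ) else 0) * X (s, x) (t, y) =
      ∑ p : Fin (k + 1), ∑ e : Equiv.Perm (Fin k),
        if (b = (Fin.cons a t : Fin (k + 1) → Fin M) p) ∧ s =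
          (fun j => (Fin.cons a t : Fin (k + 1) → Fin M) (Equiv.swap 0 p (Fin.succ j))) ∘ e
        then X (s, x) (t, y) else 0 := by
    intro s t
    -- A permutation of k + 1 slots is the image p of 0 together with a permutation e of k slots.
    rw [← Equiv.sum_comp Equiv.Perm.decomposeFin.symm, Fintype.sum_prod_type, Finset.sum_mul]
    refine Finset.sum_congr rfl fun p _ => ?_
    rw [Finset.sum_mul]
    refine Finset.sum_congr rfl fun e _ => ?_
    rw [ite_mul, one_mul, zero_mul]
    refine if_congr ?_ rfl rfl
    rw [funext_iff, Fin.forall_fin_succ, funext_iff]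
    simp
  have hsum : ∀ t : Fin k → Fin M, ∑ s : Fin k → Fin M,
      (∑ p : Fin (k + 1), ∑ e : Equiv.Perm (Fin k),
        if (b = (Fin.cons a t : Fin (k + 1) → Fin M) p) ∧ s =
          (fun j => (Fin.cons a t : Fin (k + 1) → Fin M) (Equiv.swap 0 p (Fin.succ j))) ∘ e
        then X (s, x) (t, y) else 0) =
      (k ! : ℂ) * ((if b = a then X (t, x) (t, y) else 0) +
        ∑ i, if b = t i then X (Function.update t i a, x) (t, y) else 0) := by
    intro t
    rw [Finset.sum_comm]
    have h1 : ∀ p : Fin (k + 1), ∑ s : Fin k → Fin M, (∑ e : Equiv.Perm (Fin k),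
        if (b = (Fin.cons a t : Fin (k + 1) → Fin M) p) ∧ s =
          (fun j => (Fin.cons a t : Fin (k + 1) → Fin M) (Equiv.swap 0 p (Fin.succ j))) ∘ e
        then X (s, x) (t, y) else 0) = (k ! : ℂ) *
        if b = (Fin.cons a t : Fin (k + 1) → Fin M) p then
          X (fun j => (Fin.cons a t : Fin (k + 1) → Fin M) (Equiv.swap 0 p (Fin.succ j)), x) (t, y)
        else 0 := by
      intro p
      rw [Finset.sum_comm]
      simp only [ite_and, Finset.sum_ite_irrel, Finset.sum_ite_eq', Finset.mem_univ, if_true, hX',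
        Finset.sum_const_zero, Finset.sum_const, Finset.card_univ, Fintype.card_perm,
        Fintype.card_fin, nsmul_eq_mul, mul_ite, mul_zero]
    -- The term p = 0 forces b = a and yields 1 ⊗ X_B; the term p = i + 1 puts a into slot i of t
    -- and yields the partial trace onto copy i.
    rw [Finset.sum_congr rfl fun p _ => h1 p, ← Finset.mul_sum, Fin.sum_univ_succ]
    congr 2
    · refine Finset.sum_congr rfl fun i _ => ?_
      rw [Fin.cons_succ]
      congr 3
      ext j
      by_cases hj : j = i
      · subst hj; simp
      · rw [Equiv.swap_apply_of_ne_of_ne (Fin.succ_ne_zero j) (by simpa using hj)]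
        simp [hj]
  calc _ = ∑ t : Fin k → Fin M, ∑ s : Fin k → Fin M, (∑ f : Fin M → J, (∏ a, (w (f a) : ℂ)) *
        ((∏ i, z (f ((Fin.cons a t : Fin (k + 1) → Fin M) i))) *
        star (∏ i, z (f ((Fin.cons b s : Fin (k + 1) → Fin M) i))))) * X (s, x) (t, y) := by
        simp only [Finset.sum_mul]
        rw [Finset.sum_congr rfl fun t _ => Finset.sum_comm, Finset.sum_comm, Matrix.sum_apply]
        refine Finset.sum_congr rfl fun f _ => ?_
        simp only [Matrix.kroneckerMap_apply, contractCopies, Matrix.of_apply, Matrix.smul_apply,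
          Matrix.vecMulVec_apply, Finset.mul_sum]
        rw [Finset.sum_comm]
        refine Finset.sum_congr rfl fun t _ => Finset.sum_congr rfl fun s _ => ?_
        simp only [Fin.prod_univ_succ, Fin.cons_zero, Fin.cons_succ, star_mul', smul_eq_mul,
          Function.comp_apply, Pi.star_apply]
        ring
    _ = ∑ t : Fin k → Fin M, (k ! : ℂ) * ((if b = a then X (t, x) (t, y) else 0) +
        ∑ i, if b = t i then X (Function.update t i a, x) (t, y) else 0) := by
        refine Finset.sum_congr rfl fun t _ => ?_
        rw [← hsum]
        refine Finset.sum_congr rfl fun s _ => ?_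
        rw [← hperm, sum_prod_mul_star_prod (by simpa using h)]
    _ = _ := by
        rw [← Finset.mul_sum, Finset.sum_add_distrib, Finset.sum_comm]
        rw [Finset.sum_congr rfl fun i _ => (traceOutExcept_apply i X a b x y).symm]
        simp only [hρ, Matrix.smul_apply, Matrix.add_apply,
          Matrix.kroneckerMap_apply, Matrix.one_apply, traceOutCopies, Matrix.sum_apply,
          Matrix.submatrix_apply, smul_eq_mul, Finset.sum_const, Finset.card_univ,
          Fintype.card_fin, nsmul_eq_mul, eq_comm (a := b)]
        by_cases hab : a = b <;> simp [hab]

/-! ### Trace norm estimate and de Finetti bound -/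

theorem _root_.Matrix.PosSemidef.re_trace_mul_nonneg {ι : Type*} [Fintype ι] [DecidableEq ι]
    {A B : Matrix ι ι ℂ} (hA : A.PosSemidef) (hB : B.PosSemidef) : 0 ≤ (A * B).trace.re := by
  obtain ⟨C, rfl⟩ := CStarAlgebra.nonneg_iff_eq_star_mul_self.1 hA.nonneg
  rw [Matrix.star_eq_conjTranspose, Matrix.mul_assoc, Matrix.trace_mul_comm]
  exact (Complex.nonneg_iff.1 (hB.mul_mul_conjTranspose_same C).trace_nonneg).1

/-- Trace norm of a difference of positive semidefinite matrices. -/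
theorem trace_abs_sub_le {ι : Type*} [Fintype ι] [DecidableEq ι] {A B : Matrix ι ι ℂ}
    (hA : A.PosSemidef) (hB : B.PosSemidef) :
    (CFC.abs (A - B)).trace.re ≤ A.trace.re + B.trace.re := by
  have hX : IsSelfAdjoint (A - B) := hA.1.sub hB.1
  -- With G the sign of A - B, |A - B| = G (A - B) and -1 ≤ G ≤ 1; the bound is the sum of tr (1 -
  -- G) A ≥ 0 and tr (1 + G) B ≥ 0.
  set g : ℝ → ℝ := fun x => if 0 ≤ x then 1 else -1
  have hcont : ∀ f : ℝ → ℝ, ContinuousOn f (spectrum ℝ (A - B)) := fun f =>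
    Matrix.finite_real_spectrum.continuousOn f
  have habs : CFC.abs (A - B) = cfc g (A - B) * (A - B) := by
    have h := cfc_mul g (fun x => x) (A - B) (hcont _) (hcont _)
    rw [cfc_id' ℝ (A - B)] at h
    rw [CFC.abs_eq_cfc_norm (A - B), ← h]
    refine cfc_congr fun x _ => ?_
    simp only [g, Real.norm_eq_abs]
    split_ifs with h
    · rw [abs_of_nonneg h, one_mul]
    · rw [abs_of_neg (not_le.1 h), neg_one_mul]
  have h1 : (1 - cfc g (A - B)).PosSemidef := by
    rw [← Matrix.nonneg_iff_posSemidef, sub_nonneg]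
    refine cfc_le_one g _ fun x _ => ?_
    simp only [g]; split_ifs <;> norm_num
  have h2 : (1 + cfc g (A - B)).PosSemidef := by
    rw [← Matrix.nonneg_iff_posSemidef, ← cfc_const_one ℝ (A - B),
      ← cfc_add (A - B) (fun _ => (1 : ℝ)) g (hcont _) (hcont _)]
    refine cfc_nonneg fun x _ => ?_
    simp only [g]; split_ifs <;> norm_num
  have hA' := h1.re_trace_mul_nonneg hA
  have hB' := h2.re_trace_mul_nonneg hB
  rw [habs, Matrix.mul_sub]
  rw [Matrix.sub_mul, Matrix.one_mul] at hA'
  rw [Matrix.add_mul, Matrix.one_mul] at hB'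
  simp only [Matrix.trace_sub, Matrix.trace_add, Complex.sub_re, Complex.add_re] at *
  linarith

/-- A state with a Bose-symmetric extension to `k` copies is within `2 M / (k + M)` of a separable
state. -/
theorem exists_separable_traceDist_le (hM : 1 ≤ M) (hk : 1 ≤ k) {ρ : BipOp M N}
    (hρ1 : ρ.trace = 1) (h : HasBoseSymmetricExtension k ρ) :
    ∃ σ ∈ separableStates M N, traceDist σ ρ ≤ 2 * M / (k + M) := by
  obtain ⟨X, ⟨⟨hX, hX1⟩, -, hext⟩, hbose⟩ := h
  -- Degree k + 1 counts the k contracted copies and the prepared one.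
  obtain ⟨J, _, w, z, hw, hz⟩ := exists_gaussian_quadrature (k + 1)
  have hM0 : (0 : ℝ) < M := by exact_mod_cast hM
  have hρ : ρ.PosSemidef := hext ⟨0, hk⟩ ▸ traceOutExcept_posSemidef hX _
  have hB := traceOutCopies_posSemidef hX
  have hI : ((1 : Matrix (Fin M) (Fin M) ℂ) ⊗ₖ traceOutCopies X).PosSemidef :=
    Matrix.PosSemidef.one.kronecker hB
  have hItr : ((1 : Matrix (Fin M) (Fin M) ℂ) ⊗ₖ traceOutCopies X).trace = M := by
    rw [Matrix.trace_kronecker, trace_traceOutCopies, hX1, Matrix.trace_one, Fintype.card_fin,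
      mul_one]
  have hkM : (k + M : ℂ) ≠ 0 := by exact_mod_cast (by omega : k + M ≠ 0)
  have hfac : (k ! : ℂ) ≠ 0 := by exact_mod_cast k.factorial_ne_zero
  have hA : ∀ f : Fin M → J, ((((k ! : ℝ) * (k + M))⁻¹ : ℝ) •
      ((∏ a, (w (f a) : ℂ)) • Matrix.vecMulVec (z ∘ f) (star (z ∘ f)))).PosSemidef := fun f =>
    ((Matrix.posSemidef_vecMulVec_self_star _).smul (by
      rw [← Complex.ofReal_prod]
      exact_mod_cast Finset.prod_nonneg fun a _ => hw (f a))).smul (by positivity)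
  have hsum : ∑ f : Fin M → J, ((((k ! : ℝ) * (k + M))⁻¹ : ℝ) •
      ((∏ a, (w (f a) : ℂ)) • Matrix.vecMulVec (z ∘ f) (star (z ∘ f)))) ⊗ₖ
        contractCopies (z ∘ f) X =
      (k + M : ℂ)⁻¹ • ((1 : Matrix (Fin M) (Fin M) ℂ) ⊗ₖ traceOutCopies X + (k : ℂ) • ρ) := by
    rw [Finset.sum_congr rfl fun f _ => Matrix.smul_kronecker _ _ _, ← Finset.smul_sum,
      sum_vecMulVec_kronecker_contractCopies hz hbose hext]
    ext x y
    simp only [Matrix.smul_apply, Complex.real_smul, smul_eq_mul]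
    push_cast
    field_simp
  have htr : ((k + M : ℂ)⁻¹ •
      ((1 : Matrix (Fin M) (Fin M) ℂ) ⊗ₖ traceOutCopies X + (k : ℂ) • ρ)).trace = 1 := by
    rw [Matrix.trace_smul, Matrix.trace_add, Matrix.trace_smul, hItr, hρ1]
    simp only [smul_eq_mul, mul_one]
    rw [add_comm (M : ℂ), inv_mul_cancel₀ hkM]
  refine ⟨_, sum_kronecker_mem_separableStates hA (fun f => contractCopies_posSemidef (z ∘ f) hX)
    (by rw [hsum, htr]), ?_⟩
  rw [hsum, traceDist]
  have hc : (0 : ℝ) ≤ (k + M : ℝ)⁻¹ := by positivity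
  have hdiff : (k + M : ℂ)⁻¹ •
      ((1 : Matrix (Fin M) (Fin M) ℂ) ⊗ₖ traceOutCopies X + (k : ℂ) • ρ) - ρ =
      ((k + M : ℝ)⁻¹ : ℝ) • ((1 : Matrix (Fin M) (Fin M) ℂ) ⊗ₖ traceOutCopies X) -
        ((k + M : ℝ)⁻¹ * M : ℝ) • ρ := by
    ext x y
    simp only [Matrix.smul_apply, Matrix.sub_apply, Matrix.add_apply, Complex.real_smul,
      smul_eq_mul]
    push_cast
    field_simp
    ring
  rw [hdiff]
  refine (trace_abs_sub_le (hI.smul hc) (hρ.smul (mul_nonneg hc hM0.le))).trans_eq ?_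
  rw [Matrix.trace_smul, Matrix.trace_smul, hItr, hρ1]
  simp only [Complex.smul_re, Complex.natCast_re, Complex.one_re, smul_eq_mul]
  field_simp
  ring

/-! ### Extensions of separable states -/

/-- Pure states are needed because one-sided permutations do not in general fix α^{⊗k} for a mixed
α. -/
theorem exists_spectral_sum {α : Matrix (Fin M) (Fin M) ℂ} (hα : IsDensity α) :
    ∃ (l : Fin M → ℝ) (u : Fin M → Fin M → ℂ), (∀ j, 0 ≤ l j) ∧ ∑ j, l j = 1 ∧
      (∀ j, ∑ a, u j a * star (u j a) = 1) ∧
      α = ∑ j, (l j : ℂ) • Matrix.vecMulVec (u j) (star (u j)) := by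
  obtain ⟨hα, h1⟩ := hα
  set U := (hα.1.eigenvectorUnitary : Matrix (Fin M) (Fin M) ℂ)
  refine ⟨hα.1.eigenvalues, fun j a => U a j, hα.eigenvalues_nonneg, ?_, fun j => ?_, ?_⟩
  · have := hα.1.trace_eq_sum_eigenvalues
    rw [h1] at this
    exact Complex.ofReal_injective (by rw [Complex.ofReal_sum, Complex.ofReal_one]; exact this.symm)
  · have := congrFun (congrFun (Unitary.coe_star_mul_self hα.1.eigenvectorUnitary) j) j
    simpa [Matrix.mul_apply, mul_comm, U] using this
  · conv_lhs => rw [hα.1.spectral_theorem, Unitary.conjStarAlgAut_apply]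
    ext a b
    rw [Matrix.sum_apply, Matrix.mul_apply]
    refine Finset.sum_congr rfl fun j _ => ?_
    simp only [Matrix.mul_diagonal, Matrix.smul_apply, Matrix.vecMulVec_apply, smul_eq_mul,
      Function.comp_apply, Matrix.star_apply, Pi.star_apply]
    rw [mul_comm (_ : ℂ) (RCLike.ofReal _), mul_assoc]
    rfl

/-- The extension `(u uᴴ)^{⊗ k} ⊗ β` of the product operator `u uᴴ ⊗ β`. -/
def pureExtension (k : ℕ) (u : Fin M → ℂ) (β : Matrix (Fin N) (Fin N) ℂ) : ExtOp M N k :=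
  Matrix.vecMulVec (fun s => ∏ i, u (s i)) (star fun s => ∏ i, u (s i)) ⊗ₖ β

theorem sum_prod_mul_star_prod_self {u : Fin M → ℂ} (hu : ∑ a, u a * star (u a) = 1)
    (ι : Type*) [Fintype ι] [DecidableEq ι] :
    ∑ s : ι → Fin M, (∏ i, u (s i)) * star (∏ i, u (s i)) = 1 := by
  simp only [star_prod, ← Finset.prod_mul_distrib]
  rw [← Fintype.piFinset_univ, ← Finset.prod_univ_sum (fun _ => Finset.univ)
    fun _ a => u a * star (u a)]
  rw [Finset.prod_congr rfl fun _ _ => hu, Finset.prod_const_one]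

theorem isDensity_pureExtension {u : Fin M → ℂ} (hu : ∑ a, u a * star (u a) = 1)
    {β : Matrix (Fin N) (Fin N) ℂ} (hβ : IsDensity β) : IsDensity (pureExtension k u β) := by
  refine ⟨(Matrix.posSemidef_vecMulVec_self_star _).kronecker hβ.1, ?_⟩
  rw [pureExtension, Matrix.trace_kronecker, hβ.2, mul_one]
  exact sum_prod_mul_star_prod_self hu (Fin k)

theorem copyPerm_mul_pureExtension (u : Fin M → ℂ) (β : Matrix (Fin N) (Fin N) ℂ)
    (π : Equiv.Perm (Fin k)) : copyPerm M N π * pureExtension k u β = pureExtension k u β := by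
  ext ⟨s, x⟩ q
  rw [copyPerm_mul_apply]
  simp only [pureExtension, Matrix.kroneckerMap_apply, Matrix.vecMulVec_apply, Function.comp_apply]
  rw [Equiv.prod_comp π fun i => u (s i)]

/-- Splitting off coordinate j leaves a sum over the other copies, each contributing ‖u‖² = 1. -/
theorem traceOutExcept_pureExtension {u : Fin M → ℂ} (hu : ∑ a, u a * star (u a) = 1)
    (β : Matrix (Fin N) (Fin N) ℂ) (j : Fin k) :
    traceOutExcept j (pureExtension k u β) = Matrix.vecMulVec u (star u) ⊗ₖ β := by
  ext ⟨a, x⟩ ⟨b, y⟩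
  simp only [traceOutExcept, Matrix.of_apply, pureExtension, Matrix.kroneckerMap_apply,
    Matrix.vecMulVec_apply, Pi.star_apply]
  rw [← (Equiv.funSplitAt j (Fin M)).symm.sum_comp, Fintype.sum_prod_type]
  have hprod : ∀ c (r : {i // i ≠ j} → Fin M) d,
      ∏ i, u (Function.update ((Equiv.funSplitAt j (Fin M)).symm (c, r)) j d i) =
        u d * ∏ i, u (r i) := by
    intro c r d
    rw [Fintype.prod_eq_mul_prod_subtype_ne _ j]
    simp only [Function.update_self]
    congr 1
    refine Finset.prod_congr rfl fun i _ => ?_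
    rw [Function.update_of_ne i.2]
    simp [Equiv.funSplitAt, i.2]
  have hprod' : ∀ c (r : {i // i ≠ j} → Fin M),
      ∏ i, u ((Equiv.funSplitAt j (Fin M)).symm (c, r) i) = u c * ∏ i, u (r i) := by
    intro c r
    rw [← hprod c r c]
    congr! 3
    rw [eq_comm, Function.update_eq_self_iff]
    simp [Equiv.funSplitAt]
  have hj : ∀ c (r : {i // i ≠ j} → Fin M), (Equiv.funSplitAt j (Fin M)).symm (c, r) j = c := by
    intro c r; simp [Equiv.funSplitAt]
  simp only [hprod, hprod', hj, Finset.sum_ite_irrel, Finset.sum_const_zero, Finset.sum_ite_eq',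
    Finset.mem_univ, if_true]
  calc _ = u a * star (u b) * β x y *
        ∑ r : {i // i ≠ j} → Fin M, (∏ i, u (r i)) * star (∏ i, u (r i)) := by
        rw [Finset.mul_sum]
        refine Finset.sum_congr rfl fun r _ => ?_
        rw [star_mul']
        ring
    _ = _ := by rw [sum_prod_mul_star_prod_self hu, mul_one]

/-- The adjoint of P X = X is X Pᴴ = X. -/
theorem isSymmetric_of_bose {X : ExtOp M N k} (hX : X.IsHermitian)
    (h : ∀ π : Equiv.Perm (Fin k), copyPerm M N π * X = X) (π : Equiv.Perm (Fin k)) :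
    copyPerm M N π * X * (copyPerm M N π).conjTranspose = X := by
  rw [h]
  have := congrArg Matrix.conjTranspose (h π)
  rwa [Matrix.conjTranspose_mul, hX.eq] at this

theorem traceOutExcept_sum_smul {J : Type*} [Fintype J] (j : Fin k) (c : J → ℂ)
    (X : J → ExtOp M N k) :
    traceOutExcept j (∑ i, c i • X i) = ∑ i, c i • traceOutExcept j (X i) := by
  ext ⟨a, x⟩ ⟨b, y⟩
  simp only [traceOutExcept, Matrix.of_apply, Matrix.sum_apply, Matrix.smul_apply, smul_eq_mul,
    Finset.mul_sum, mul_ite, mul_zero]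
  rw [Finset.sum_comm]
  refine Finset.sum_congr rfl fun s _ => ?_
  split_ifs <;> simp

/-- Separable states have Bose-symmetric extensions to any number of copies. -/
theorem hasBoseSymmetricExtension_of_separable {ρ : BipOp M N} (h : ρ ∈ separableStates M N) :
    HasBoseSymmetricExtension k ρ := by
  obtain ⟨n, p, α, β, hp, hp1, hα, hβ, rfl⟩ := h
  choose l u hl hl1 hu hα using fun i => exists_spectral_sum (hα i)
  set X : ExtOp M N k := ∑ q : Fin n × Fin M, ((p q.1 * l q.1 q.2 : ℝ) : ℂ) •
    pureExtension k (u q.1 q.2) (β q.1)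
  have hbose : ∀ π : Equiv.Perm (Fin k), copyPerm M N π * X = X := fun π => by
    simp only [X, Matrix.mul_sum, Matrix.mul_smul, copyPerm_mul_pureExtension]
  have hX : X.PosSemidef := Matrix.posSemidef_sum _ fun q _ =>
    (isDensity_pureExtension (hu q.1 q.2) (hβ q.1)).1.smul
      (by exact_mod_cast mul_nonneg (hp q.1) (hl q.1 q.2))
  refine ⟨X, ⟨⟨⟨hX, ?_⟩, fun i j => isSymmetric_of_bose hX.1 hbose _, fun j => ?_⟩, hbose⟩⟩
  · simp only [X, Matrix.trace_sum, Matrix.trace_smul,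
      (isDensity_pureExtension (hu _ _) (hβ _)).2, smul_eq_mul, mul_one]
    rw [← Complex.ofReal_sum, Fintype.sum_prod_type]
    simp [← Finset.mul_sum, hl1, hp1]
  · rw [traceOutExcept_sum_smul, Fintype.sum_prod_type]
    refine Finset.sum_congr rfl fun i _ => ?_
    simp only [traceOutExcept_pureExtension (hu _ _)]
    conv_rhs => rw [hα i]
    ext x y
    simp only [Matrix.sum_apply, Matrix.smul_apply, Matrix.kroneckerMap_apply, smul_eq_mul,
      Finset.sum_mul, Finset.mul_sum]
    refine Finset.sum_congr rfl fun j _ => ?_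
    push_cast
    ring

end

end QuantumSep

/-! ### Weak membership -/

theorem mainTheorem3 (M N : ℕ) (hM : 1 ≤ M) (hN : 1 ≤ N) (δ : ℝ) (hδ : 0 < δ) :
    QuantumSep.SolvesWMEM (QuantumSep.separableStates M N) δ
      (QuantumSep.HasBoseSymmetricExtension ⌈4 * (M : ℝ) / δ⌉₊) := by
  intro p hp
  have hM0 : (0 : ℝ) < M := by exact_mod_cast hM
  have hpos : 0 < 4 * (M : ℝ) / δ := by positivity
  refine ⟨fun h => ?_, fun h hin => h ?_⟩
  · obtain ⟨σ, hσ, hdist⟩ := QuantumSep.exists_separable_traceDist_le hM (Nat.ceil_pos.2 hpos) hp.2 h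
    refine Set.mem_biUnion hσ ⟨hp, hdist.trans ?_⟩
    have hceil := Nat.le_ceil (4 * (M : ℝ) / δ)
    rw [div_le_iff₀ hδ] at hceil
    rw [div_le_iff₀ (by positivity)]
    -- From 4M ≤ kδ follows 2M ≤ δ (k + M), with a factor 2 to spare.
    nlinarith
  -- A point of the inner set lies in its own ball, so it is separable.
  · refine QuantumSep.hasBoseSymmetricExtension_of_separable (hin.2 ⟨hp, ?_⟩)
    simpa [QuantumSep.traceDist] using hδ.le
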